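/- For integers $m\ge 1$ and $r\ge 1$, let $T_r(m)$ denote the Turán graph, i.e. the $m$-vertex complete $r$-partite graph with part sizes as equal as possible (so $T_r(m)=K_m$ if $m\le r$), and let $e(G)$ denote the number of edges of $G$. All graphs are finite and simple. A graph is Hamiltonian-connected if every two distinct vertices are joined by a Hamiltonian path. Let $r\ge 3$, and let $n\ge 32$ if $r=3$, $n\ge 16$ if $r=4$, and $n\ge 11$ if $r\ge 5$. Let $G$ be an $n$-vertex $K_{r+1}$-free graph. If $G$ is not Hamiltonian-connected, then $$e(G)\le e(T_r(n-1))+2.$$ Moreover, $G$ is not Hamiltonian-connected and satisfies $e(G)=e(T_r(n-1))+2$ if and only if $G$ consists of $T_r(n-1)$ plus a vertex of degree $2$, i.e. $G$ has a vertex $v$ of degree $2$ such that $G-v$ is isomorphic to $T_r(n-1)$. -/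

import Mathlib

namespace HamConn

/-- A graph is Hamiltonian-connected if every pair of distinct vertices is joined by a
Hamiltonian path. -/
def IsHamiltonianConnected {V : Type*} [DecidableEq V] (G : SimpleGraph V) : Prop :=
  ∀ u v : V, u ≠ v → ∃ p : G.Walk u v, p.IsHamiltonian

/-- With `n` the number of vertices of `G`: the graph `G` is `K_{r+1}`-free and consists of the
Turán graph `T_r(n-1)` plus a vertex of degree `d`, i.e. some vertex `v` has degree `d` in `G`
and deleting `v` leaves a graph isomorphic to `T_r(n-1)`. -/
def IsTuranPlusVertex {V : Type*} [Fintype V] (G : SimpleGraph V) [DecidableRel G.Adj]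
    (r d : ℕ) : Prop :=
  G.CliqueFree (r + 1) ∧
    ∃ v : V, G.degree v = d ∧
      Nonempty (G.induce {v}ᶜ ≃g SimpleGraph.turanGraph (Fintype.card V - 1) r)

end HamConn

namespace HamConn

open Finset

/-! If `G` has no Hamiltonian `u`–`v` path, an edge-maximal supergraph without one has degree sum at
most `n` on every nonadjacent pair (Ore). A nonadjacent pair of maximal degree sum then yields `k -
1` vertices of degree at most `k` in `G`, for some `2 ≤ k ≤ n / 2`
(`exists_card_of_not_isHamiltonianConnected`).

For `k = 2`, deleting the low-degree vertex and applying Turán's theorem gives the bound, and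
uniqueness in Turán's theorem gives the equality case. For `k ≥ 3`, deleting all `k - 1` vertices
gives a strict inequality (`turanNumber_add_lt`) except in a few boundary cases. There, disjoint
copies of `K_r` are removed from the remaining set `U`: few copies make `U` sparse, many copies
limit the edges into `U`, since each vertex misses a vertex of every copy
(`exists_card_filter_adj_add_le`). -/

/-- A Hamiltonian path of `G` from `u` to `v`, as a sequence indexed by `0, …, |V| - 1`. -/
structure IsHamSeq {V : Type*} [Fintype V] (G : SimpleGraph V) (u v : V) (f : ℕ → V) :
    Prop where
  inj : Set.InjOn f (Set.Iio (Fintype.card V))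
  zero : f 0 = u
  last : f (Fintype.card V - 1) = v
  adj : ∀ i, i + 1 < Fintype.card V → G.Adj (f i) (f (i + 1))

/-! ### Hamiltonian paths and degree conditions -/

section Paths

variable {V : Type*} {G : SimpleGraph V} {u v : V} {f : ℕ → V}

lemma exists_walk_support_eq_map_range (f : ℕ → V) (m : ℕ)
    (h : ∀ i < m, G.Adj (f i) (f (i + 1))) :
    ∃ p : G.Walk (f 0) (f m), p.support = (List.range (m + 1)).map f := by
  induction m with
  | zero => exact ⟨.nil, by simp⟩
  | succ m ih =>
    obtain ⟨p, hp⟩ := ih fun i hi => h i (by omega)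
    refine ⟨p.concat (h m (by omega)), ?_⟩
    rw [SimpleGraph.Walk.support_concat, hp, List.range_succ (n := m + 1)]
    simp

variable [Fintype V]

lemma IsHamSeq.exists_walk [DecidableEq V] (h : IsHamSeq G u v f) :
    ∃ p : G.Walk u v, p.IsHamiltonian := by
  have hpos : 0 < Fintype.card V := Fintype.card_pos_iff.2 ⟨u⟩
  obtain ⟨p, hp⟩ := exists_walk_support_eq_map_range (G := G) f (Fintype.card V - 1)
    fun i hi => h.adj i (by omega)
  obtain rfl := h.zero
  obtain rfl := h.last
  refine ⟨p, SimpleGraph.Walk.isHamiltonian_iff_isPath_and_length_eq.2 ⟨?_, ?_⟩⟩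
  · refine SimpleGraph.Walk.IsPath.mk' ?_
    rw [hp]
    refine List.Nodup.map_on (fun x hx y hy hxy => h.inj ?_ ?_ hxy) List.nodup_range
    · simp only [List.mem_range] at hx; simp only [Set.mem_Iio]; omega
    · simp only [List.mem_range] at hy; simp only [Set.mem_Iio]; omega
  · have := congrArg List.length hp
    simp at this
    omega

/-- Reversing the segment `f a, …, f b` of a Hamiltonian path. -/
lemma isHamSeq_reverse_segment (hinj : Set.InjOn f (Set.Iio (Fintype.card V)))
    (h0 : f 0 = u) (hl : f (Fintype.card V - 1) = v) {a b : ℕ} (hab : a < b)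
    (hb : b + 1 < Fintype.card V)
    (hadj : ∀ i, i + 1 < Fintype.card V → i ≠ a → i ≠ b → G.Adj (f i) (f (i + 1)))
    (h1 : G.Adj (f a) (f b)) (h2 : G.Adj (f (a + 1)) (f (b + 1))) :
    IsHamSeq G u v fun i => if a < i ∧ i ≤ b then f (a + 1 + b - i) else f i where
  inj := by
    intro x hx y hy hxy
    simp only [Set.mem_Iio] at hx hy
    simp only at hxy
    split_ifs at hxy with c d d <;>
      have := hinj (by simp only [Set.mem_Iio]; omega) (by simp only [Set.mem_Iio]; omega) hxy <;>
      omega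
  zero := by simpa using h0
  last := by rw [if_neg (by omega)]; exact hl
  adj := by
    intro i hi
    by_cases hia : i = a
    · subst hia
      rw [if_neg (by omega), if_pos (by omega), show i + 1 + b - (i + 1) = b by omega]
      exact h1
    by_cases hib : i = b
    · subst hib
      rw [if_pos (by omega), if_neg (by omega), show a + 1 + i - i = a + 1 by omega]
      exact h2
    by_cases hi' : a < i ∧ i ≤ b
    · rw [if_pos hi', if_pos (by omega)]
      have := hadj (a + 1 + b - (i + 1)) (by omega) (by omega) (by omega)
      rw [show a + 1 + b - (i + 1) + 1 = a + 1 + b - i by omega] at this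
      exact this.symm
    · rw [if_neg hi', if_neg (by omega)]
      exact hadj i hi hia hib

/-- Shows that a graph with no Hamiltonian `u`–`v` path is not complete, so the maximal supergraph
has a nonadjacent pair. -/
lemma exists_isHamSeq_top (huv : u ≠ v) : ∃ f, IsHamSeq (⊤ : SimpleGraph V) u v f := by
  classical
  have hc : 1 < Fintype.card V := Fintype.one_lt_card_iff.2 ⟨u, v, huv⟩
  obtain ⟨n, hn⟩ : ∃ n, Fintype.card V = n + 2 := ⟨Fintype.card V - 2, by omega⟩
  let e := (Fintype.equivFinOfCardEq hn).symm
  let e₁ := e.trans (Equiv.swap (e 0) u)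
  let e₂ := e₁.trans (Equiv.swap (e₁ (Fin.last (n + 1))) v)
  have h₁ : e₁ 0 = u := by simp [e₁]
  have h₂ : e₂ (Fin.last (n + 1)) = v := by simp [e₂]
  have h₃ : e₂ 0 = u := by
    simp only [e₂, Equiv.trans_apply, h₁]
    refine Equiv.swap_apply_of_ne_of_ne ?_ huv
    rw [← h₁]
    exact e₁.injective.ne (by simp [Fin.ext_iff])
  have key : ∀ i j, i < n + 2 → j < n + 2 →
      e₂ (Fin.ofNat (n + 2) i) = e₂ (Fin.ofNat (n + 2) j) → i = j := by
    intro i j hi hj h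
    have := congrArg Fin.val (e₂.injective h)
    simpa [Fin.ofNat, Nat.mod_eq_of_lt hi, Nat.mod_eq_of_lt hj] using this
  refine ⟨fun i => e₂ (Fin.ofNat (n + 2) i), ?_, ?_, ?_, ?_⟩
  · intro i hi j hj h
    rw [hn] at hi hj
    exact key i j hi hj h
  · exact h₃
  · rw [hn, ← h₂]
    congr 1
    ext
    simp [Fin.ofNat]
  · intro i hi h
    rw [hn] at hi
    have := key i (i + 1) (by omega) hi h
    omega

/-- **Ore's lemma** for Hamiltonian paths with prescribed ends: if adding the edge `xy` creates
one, then the degrees of `x` and `y` add up to at most the number of vertices. -/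
lemma degree_add_degree_le_of_isHamSeq_sup_edge [DecidableRel G.Adj] {x y : V}
    (hG : ∀ g, ¬ IsHamSeq G u v g) (h : IsHamSeq (G ⊔ SimpleGraph.edge x y) u v f) :
    G.degree x + G.degree y ≤ Fintype.card V := by
  classical
  set n := Fintype.card V with hn
  have hstep : ∀ i, i + 1 < n → ¬ G.Adj (f i) (f (i + 1)) →
      (f i = x ∧ f (i + 1) = y) ∨ (f i = y ∧ f (i + 1) = x) := by
    intro i hi hni
    have := h.adj i hi
    simp only [SimpleGraph.sup_adj, hni, false_or, SimpleGraph.edge_adj] at this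
    tauto
  obtain ⟨i, hi, hni⟩ : ∃ i, i + 1 < n ∧ ¬ G.Adj (f i) (f (i + 1)) := by
    by_contra! hcon
    exact hG f ⟨h.inj, h.zero, h.last, hcon⟩
  have inj : ∀ a b, a < n → b < n → f a = f b → a = b := fun a b ha hb hab => h.inj ha hb hab
  have hother : ∀ j, j + 1 < n → j ≠ i → G.Adj (f j) (f (j + 1)) := by
    intro j hj hji
    by_contra hnj
    rcases hstep i hi hni with ⟨h1, h2⟩ | ⟨h1, h2⟩ <;>
      rcases hstep j hj hnj with ⟨h3, h4⟩ | ⟨h3, h4⟩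
    · exact hji (inj _ _ (by omega) (by omega) (h3.trans h1.symm))
    · have := inj _ _ (by omega) (by omega) (h3.trans h2.symm)
      have := inj _ _ (by omega) (by omega) (h4.trans h1.symm)
      omega
    · have := inj _ _ (by omega) (by omega) (h3.trans h2.symm)
      have := inj _ _ (by omega) (by omega) (h4.trans h1.symm)
      omega
    · exact hji (inj _ _ (by omega) (by omega) (h3.trans h1.symm))
  have hno : ∀ j, j + 1 < n → G.Adj (f i) (f j) → ¬ G.Adj (f (i + 1)) (f (j + 1)) := by
    intro j hj h1 h2
    rcases lt_trichotomy i j with hij | rfl | hij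
    · exact hG _ (isHamSeq_reverse_segment h.inj h.zero h.last hij hj
        (fun l hl hli _ => hother l hl hli) h1 h2)
    · exact G.loopless.irrefl _ h1
    · exact hG _ (isHamSeq_reverse_segment h.inj h.zero h.last hij hi
        (fun l hl _ hli => hother l hl hli) h1.symm h2.symm)
  have hsurj : ∀ w, ∃ j < n, f j = w := by
    have himg : (range n).image f = univ := by
      rw [← card_eq_iff_eq_univ, card_image_of_injOn, card_range]
      intro a ha b hb hab
      exact inj a b (by simpa using ha) (by simpa using hb) hab
    intro w
    have : w ∈ (range n).image f := by rw [himg]; exact mem_univ w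
    simpa using this
  -- `A` and `B` are disjoint by `hno` and both omit `i`. Each misses at most one neighbour: `A` the
  -- one at the last position, `B` the one at position `0`.
  let A := (range (n - 1)).filter fun j => G.Adj (f i) (f j)
  let B := (range (n - 1)).filter fun j => G.Adj (f (i + 1)) (f (j + 1))
  have hA : G.degree (f i) ≤ #A + 1 := by
    rw [← G.card_neighborFinset_eq_degree]
    calc #(G.neighborFinset (f i)) ≤ #((insert (n - 1) A).image f) := by
          refine card_le_card fun w hw => ?_
          obtain ⟨j, hj, rfl⟩ := hsurj w
          rw [SimpleGraph.mem_neighborFinset] at hw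
          refine mem_image_of_mem f ?_
          by_cases hj' : j = n - 1
          · simp [hj']
          · exact mem_insert_of_mem (mem_filter.2 ⟨mem_range.2 (by omega), hw⟩)
      _ ≤ #(insert (n - 1) A) := card_image_le
      _ ≤ #A + 1 := card_insert_le _ _
  have hB : G.degree (f (i + 1)) ≤ #B + 1 := by
    rw [← G.card_neighborFinset_eq_degree]
    calc #(G.neighborFinset (f (i + 1))) ≤ #(insert (f 0) (B.image fun j => f (j + 1))) := by
          refine card_le_card fun w hw => ?_
          obtain ⟨j, hj, rfl⟩ := hsurj w
          rw [SimpleGraph.mem_neighborFinset] at hw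
          rcases j with _ | j
          · exact mem_insert_self _ _
          · exact mem_insert_of_mem (mem_image_of_mem (fun j => f (j + 1))
              (mem_filter.2 ⟨mem_range.2 (by omega), hw⟩))
      _ ≤ #(B.image fun j => f (j + 1)) + 1 := card_insert_le _ _
      _ ≤ #B + 1 := by gcongr; exact card_image_le
  have hAB : #A + #B ≤ n - 2 := by
    have hdisj : Disjoint A B := by
      rw [disjoint_left]
      intro j hjA hjB
      simp only [A, B, mem_filter, mem_range] at hjA hjB
      exact hno j (by omega) hjA.2 hjB.2
    rw [← card_union_of_disjoint hdisj]
    calc #(A ∪ B) ≤ #((range (n - 1)).erase i) := by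
          refine card_le_card fun j hj => ?_
          simp only [A, B, mem_union, mem_filter, mem_range] at hj
          refine mem_erase.2 ⟨?_, mem_range.2 (by omega)⟩
          rintro rfl
          rcases hj with hj | hj
          · exact G.loopless.irrefl _ hj.2
          · exact G.loopless.irrefl _ hj.2
      _ = n - 2 := by rw [card_erase_of_mem (mem_range.2 (by omega)), card_range]; omega
  have : G.degree (f i) + G.degree (f (i + 1)) ≤ n := by omega
  rcases hstep i hi hni with ⟨h1, h2⟩ | ⟨h1, h2⟩ <;> rw [h1, h2] at this <;> omega

/-- A Pósa-type condition for Hamiltonian-connectedness. -/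
lemma exists_card_of_not_isHamiltonianConnected [DecidableEq V] [DecidableRel G.Adj]
    (hn : 4 ≤ Fintype.card V) (hG : ¬ IsHamiltonianConnected G) :
    ∃ k, 2 ≤ k ∧ 2 * k ≤ Fintype.card V ∧
      ∃ S : Finset V, #S = k - 1 ∧ ∀ w ∈ S, G.degree w ≤ k := by
  classical
  simp only [IsHamiltonianConnected, not_forall] at hG
  obtain ⟨u, v, huv, hno⟩ := hG
  obtain ⟨M, hGM, hM⟩ := (Set.toFinite {H : SimpleGraph V | ∀ f, ¬ IsHamSeq H u v f}).exists_le_maximal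
    (a := G) fun f hf => hno hf.exists_walk
  have hMno : ∀ f, ¬ IsHamSeq M u v f := hM.prop
  have hore : ∀ x y, x ≠ y → ¬ M.Adj x y → M.degree x + M.degree y ≤ Fintype.card V := by
    intro x y hxy hadj
    have hlt : ¬ (M ⊔ SimpleGraph.edge x y) ≤ M := fun hle =>
      hadj (hle (Or.inr ((SimpleGraph.edge_adj ..).2 ⟨Or.inl ⟨rfl, rfl⟩, hxy⟩)))
    have : ¬ ∀ f, ¬ IsHamSeq (M ⊔ SimpleGraph.edge x y) u v f := fun hcon =>
      hlt (hM.le_of_ge hcon le_sup_left)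
    push Not at this
    obtain ⟨f, hf⟩ := this
    exact degree_add_degree_le_of_isHamSeq_sup_edge hMno hf
  let P : Finset (V × V) := univ.filter fun p => p.1 ≠ p.2 ∧ ¬ M.Adj p.1 p.2
  have hP : P.Nonempty := by
    by_contra hcon
    rw [not_nonempty_iff_eq_empty, filter_eq_empty_iff] at hcon
    obtain ⟨f, hf⟩ := exists_isHamSeq_top huv
    refine hMno f ⟨hf.inj, hf.zero, hf.last, fun i hi => ?_⟩
    have := hcon (mem_univ (f i, f (i + 1)))
    have hne : f i ≠ f (i + 1) := hf.adj i hi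
    tauto
  obtain ⟨x, y, hxy, hadj, hdeg, hmax⟩ : ∃ x y, x ≠ y ∧ ¬ M.Adj x y ∧ M.degree x ≤ M.degree y ∧
      ∀ w, w ≠ y → ¬ M.Adj w y → M.degree w ≤ M.degree x := by
    obtain ⟨⟨x, y⟩, hp, hmax⟩ := exists_max_image P (fun p => M.degree p.1 + M.degree p.2) hP
    simp only [P, mem_filter, mem_univ, true_and, Prod.forall] at hp hmax
    rcases le_total (M.degree x) (M.degree y) with hle | hle
    · refine ⟨x, y, hp.1, hp.2, hle, fun w hw hwy => ?_⟩
      have := hmax w y ⟨hw, hwy⟩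
      omega
    · refine ⟨y, x, hp.1.symm, fun h => hp.2 h.symm, hle, fun w hw hwy => ?_⟩
      have := hmax w x ⟨hw, hwy⟩
      omega
  have hsum := hore x y hxy hadj
  have hdegle : ∀ w, G.degree w ≤ M.degree w := fun w => by
    exact SimpleGraph.degree_le_of_le hGM
  -- Take `k = M.degree x`: the non-neighbours of `y` have degree at most `k`, and there are `n - 1
  -- - M.degree y ≥ k - 1` of them by `hsum`. If `M.degree x ≤ 1`, the single vertex `x` serves for
  -- `k = 2`.
  by_cases hk : 2 ≤ M.degree x
  · refine ⟨M.degree x, hk, by omega, ?_⟩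
    let N := univ.filter fun w => w ≠ y ∧ ¬ M.Adj w y
    have hN : M.degree x - 1 ≤ #N := by
      have hcompl : N = (insert y (M.neighborFinset y))ᶜ := by
        ext w
        simp [N, M.adj_comm]
      rw [hcompl, card_compl, card_insert_of_notMem (by simp), M.card_neighborFinset_eq_degree]
      omega
    obtain ⟨S, hSN, hS⟩ := exists_subset_card_eq hN
    refine ⟨S, hS, fun w hw => (hdegle w).trans ?_⟩
    have := hSN hw
    simp only [N, mem_filter, mem_univ, true_and] at this
    exact hmax w this.1 this.2
  · refine ⟨2, le_rfl, by omega, {x}, by simp, fun w hw => ?_⟩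
    rw [mem_singleton] at hw
    have := hdegle w
    rw [hw] at this ⊢
    omega

/-- The neighbours of a vertex of degree two are not joined by a Hamiltonian path. -/
lemma not_isHamiltonianConnected_of_degree_eq_two [DecidableEq V] [DecidableRel G.Adj]
    (hn : 4 ≤ Fintype.card V) {w : V} (hw : G.degree w = 2) : ¬ IsHamiltonianConnected G := by
  intro hG
  rw [← G.card_neighborFinset_eq_degree, card_eq_two] at hw
  obtain ⟨a, b, hab, hN⟩ := hw
  have hmem : ∀ c, G.Adj w c ↔ c = a ∨ c = b := fun c => by
    rw [← G.mem_neighborFinset, hN]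
    simp
  obtain ⟨p, hp⟩ := hG a b hab
  have hinj := hp.isPath.getVert_injOn
  have hlen := hp.length_eq
  obtain ⟨i, hi, hil⟩ := SimpleGraph.Walk.mem_support_iff_exists_getVert.1 (hp.mem_support w)
  have hwa : w ≠ a := ((hmem a).2 (Or.inl rfl)).ne
  have hwb : w ≠ b := ((hmem b).2 (Or.inr rfl)).ne
  have hi0 : i ≠ 0 := by
    rintro rfl
    exact hwa (by rw [← hi]; simp)
  have hiL : i ≠ p.length := by
    rintro rfl
    exact hwb (by rw [← hi]; simp)
  have hends : ∀ j, j ≤ p.length → G.Adj w (p.getVert j) → j = 0 ∨ j = p.length := by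
    intro j hj hadj
    rcases (hmem _).1 hadj with h | h
    · exact Or.inl (hinj hj (Nat.zero_le p.length) (by rw [h]; simp))
    · exact Or.inr (hinj hj (le_refl p.length) (by rw [h]; simp))
  -- Both path-neighbours of `w` are ends of the path, so the path has only three vertices.
  have h1 := hends (i + 1) (by omega) (by
    rw [← hi]; exact p.adj_getVert_succ (by omega))
  have h2 := hends (i - 1) (by omega) (by
    have := p.adj_getVert_succ (i := i - 1) (by omega)
    rw [show i - 1 + 1 = i by omega, hi] at this
    exact this.symm)
  omega

end Paths

/-! ### Turán numbers and their growth -/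

section Turan

/-- The number of edges of the Turán graph with `m` vertices and `r` parts, built up one vertex
at a time. -/
def turanNumber (r m : ℕ) : ℕ := ∑ x ∈ range m, (x - x / r)

lemma turanNumber_succ (r m : ℕ) : turanNumber r (m + 1) = turanNumber r m + (m - m / r) :=
  sum_range_succ _ _

lemma turanNumber_of_le {r m : ℕ} (h : m ≤ r) : turanNumber r m = m.choose 2 := by
  rw [turanNumber, Nat.choose_two_right, ← sum_range_id]
  refine sum_congr rfl fun x hx => ?_
  rw [mem_range] at hx
  rw [Nat.div_eq_of_lt (by omega), Nat.sub_zero]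

lemma turanNumber_add {r : ℕ} (hr : 0 < r) (m : ℕ) :
    turanNumber r (m + r) = turanNumber r m + m * (r - 1) + r.choose 2 := by
  induction m with
  | zero => rw [zero_add, turanNumber_of_le le_rfl]; simp [turanNumber]
  | succ m ih =>
    rw [show m + 1 + r = m + r + 1 by omega, turanNumber_succ, turanNumber_succ, ih,
      Nat.add_div_right _ hr, add_mul]
    have := Nat.div_le_self m r
    omega

lemma card_edgeFinset_turanGraph_eq {r : ℕ} (hr : 0 < r) (m : ℕ) :
    #(SimpleGraph.turanGraph m r).edgeFinset = turanNumber r m := by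
  induction m using Nat.strong_induction_on with
  | _ m ih =>
    rcases le_or_gt r m with h | h
    · obtain ⟨m, rfl⟩ := Nat.exists_eq_add_of_le' h
      rw [SimpleGraph.card_edgeFinset_turanGraph_add, turanNumber_add hr, ih m (by omega)]
    · rw [turanNumber_of_le h.le]
      have := SimpleGraph.card_edgeFinset_top_eq_card_choose_two (V := Fin m)
      rw [Fintype.card_fin] at this
      convert! this
      exact SimpleGraph.turanGraph_eq_top.2 (.inr h.le)

lemma turanNumber_three (m : ℕ) : 3 * turanNumber 3 m + (if m % 3 = 0 then 0 else 1) = m ^ 2 := by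
  induction m with
  | zero => rfl
  | succ m ih =>
    have : (m + 1) ^ 2 = m ^ 2 + 2 * m + 1 := by ring
    rw [turanNumber_succ, this]
    split_ifs at * <;> omega

lemma turanNumber_four (m : ℕ) :
    8 * turanNumber 4 m + (if m % 4 = 0 then 0 else if m % 4 = 2 then 4 else 3) = 3 * m ^ 2 := by
  induction m with
  | zero => rfl
  | succ m ih =>
    have : (m + 1) ^ 2 = m ^ 2 + 2 * m + 1 := by ring
    rw [turanNumber_succ, this]
    split_ifs at * <;> omega

lemma turanNumber_five (m : ℕ) :
    5 * turanNumber 5 m + (if m % 5 = 0 then 0 else if m % 5 = 1 ∨ m % 5 = 4 then 2 else 3) =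
      2 * m ^ 2 := by
  induction m with
  | zero => rfl
  | succ m ih =>
    have : (m + 1) ^ 2 = m ^ 2 + 2 * m + 1 := by ring
    rw [turanNumber_succ, this]
    split_ifs at * <;> omega

/-- Each increment `x - x / r` is nondecreasing in `r`; this reduces `r ≥ 5` to `r = 5` below. -/
lemma turanNumber_add_le_of_le {r s : ℕ} (hr : 0 < r) (hrs : r ≤ s) (m d : ℕ) :
    turanNumber s m + turanNumber r (m + d) ≤ turanNumber s (m + d) + turanNumber r m := by
  induction d with
  | zero => simp [add_comm]
  | succ d ih =>
    rw [← add_assoc, turanNumber_succ, turanNumber_succ]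
    have := Nat.div_le_div_left (a := m + d) hrs hr
    omega

/-- Deleting `k - 1` vertices of degree at most `k` from a graph with many edges leaves too many
edges for a `K_{r+1}`-free graph, apart from the boundary cases `r = 3`, `k = ⌊n / 2⌋` and
`r = 4`, `n = 16`, `k = 8`. -/
lemma turanNumber_add_lt {n r k : ℕ} (hr : 3 ≤ r)
    (hn : (if r = 3 then 32 else if r = 4 then 16 else 11) ≤ n) (hk : 3 ≤ k) (hkn : 2 * k ≤ n)
    (h3 : r = 3 → 2 * k + 2 ≤ n) (h4 : ¬ (r = 4 ∧ n = 16 ∧ k = 8)) :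
    turanNumber r (n - k + 1) + k * (k - 1) < turanNumber r (n - 1) + 2 := by
  obtain ⟨j, rfl⟩ : ∃ j, k = j + 2 := ⟨k - 2, by omega⟩
  obtain ⟨m, rfl⟩ : ∃ m, n = m + (j + 2) := ⟨n - (j + 2), by omega⟩
  rw [show m + (j + 2) - (j + 2) + 1 = m + 1 by omega,
    show m + (j + 2) - 1 = m + 1 + j by omega, show j + 2 - 1 = j + 1 by omega]
  rcases (show r = 3 ∨ r = 4 ∨ 5 ≤ r by omega) with rfl | rfl | hr5
  · have a := turanNumber_three (m + 1)
    have b := turanNumber_three (m + 1 + j)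
    have := h3 rfl
    simp only [if_true] at hn
    -- The inequality times 3, with `+ 1` absorbing the worst residue correction. The cases `r = 4`
    -- and `r = 5` are scaled by 8 and 5, with corrections 4 and 3.
    have key : (m + 1) ^ 2 + 3 * ((j + 2) * (j + 1)) + 1 < (m + 1 + j) ^ 2 + 6 := by
      rcases (show j = 1 ∨ 2 ≤ j by omega) with rfl | hj
      · nlinarith
      · nlinarith
    split_ifs at a b <;> omega
  · have a := turanNumber_four (m + 1)
    have b := turanNumber_four (m + 1 + j)
    norm_num at hn
    have key : 3 * (m + 1) ^ 2 + 8 * ((j + 2) * (j + 1)) + 4 < 3 * (m + 1 + j) ^ 2 + 16 := by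
      rcases le_or_gt j 6 with hj | hj
      · interval_cases j <;> ring_nf <;> omega
      · nlinarith
    split_ifs at a b <;> omega
  · have a := turanNumber_five (m + 1)
    have b := turanNumber_five (m + 1 + j)
    have c := turanNumber_add_le_of_le (by norm_num) hr5 (m + 1) j
    rw [if_neg (by omega), if_neg (by omega)] at hn
    have key : 2 * (m + 1) ^ 2 + 5 * ((j + 2) * (j + 1)) + 3 < 2 * (m + 1 + j) ^ 2 + 10 := by
      rcases le_or_gt j 4 with hj | hj
      · interval_cases j <;> ring_nf <;> omega
      · nlinarith
    split_ifs at a b <;> omega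

end Turan

/-! ### Counting adjacencies and removing cliques -/

section AdjCount

variable {V : Type*} (G : SimpleGraph V) [DecidableRel G.Adj]

/-- The number of pairs `(a, b)` with `a ∈ A`, `b ∈ B` and `a`, `b` adjacent. -/
def adjCount (A B : Finset V) : ℕ := ∑ a ∈ A, #{b ∈ B | G.Adj a b}

lemma adjCount_comm (A B : Finset V) : adjCount G A B = adjCount G B A := by
  simp only [adjCount, card_filter]
  rw [sum_comm]
  simp only [G.adj_comm]

lemma adjCount_union_left [DecidableEq V] {A B : Finset V} (C : Finset V) (h : Disjoint A B) :
    adjCount G (A ∪ B) C = adjCount G A C + adjCount G B C := sum_union h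

lemma card_filter_adj_union [DecidableEq V] {B C : Finset V} (a : V) (h : Disjoint B C) :
    #{b ∈ B ∪ C | G.Adj a b} = #{b ∈ B | G.Adj a b} + #{b ∈ C | G.Adj a b} := by
  rw [filter_union, card_union_of_disjoint (disjoint_filter_filter h)]

lemma adjCount_union_right [DecidableEq V] (A : Finset V) {B C : Finset V} (h : Disjoint B C) :
    adjCount G A (B ∪ C) = adjCount G A B + adjCount G A C := by
  rw [adjCount_comm, adjCount_union_left G A h, adjCount_comm G B, adjCount_comm G C]

lemma adjCount_le {A B : Finset V} {d : ℕ} (h : ∀ a ∈ A, #{b ∈ B | G.Adj a b} ≤ d) :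
    adjCount G A B ≤ #A * d := by
  simpa [adjCount] using sum_le_card_nsmul A _ d h

lemma card_filter_adj_univ [Fintype V] (a : V) : #{b | G.Adj a b} = G.degree a := by
  rw [← G.card_neighborFinset_eq_degree, G.neighborFinset_eq_filter]

lemma adjCount_univ [Fintype V] : adjCount G univ univ = 2 * #G.edgeFinset := by
  rw [← G.sum_degrees_eq_twice_card_edges, adjCount]
  exact sum_congr rfl fun a _ => card_filter_adj_univ G a

variable {G}

/-- **Turán's theorem** for the graph induced on `U`. -/
lemma adjCount_self_le {r : ℕ} (hr : 0 < r) (U : Finset V) (h : G.CliqueFreeOn U (r + 1)) :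
    adjCount G U U ≤ 2 * turanNumber r #U := by
  classical
  have hfree : (G.induce (U : Set V)).CliqueFree (r + 1) :=
    (G.cliqueFree_induce_iff _ _).2 h
  have hle := hfree.card_edgeFinset_le
  simp only [SetLike.coe_sort_coe, Fintype.card_coe] at hle
  rw [← SimpleGraph.card_edgeFinset_turanGraph, card_edgeFinset_turanGraph_eq hr] at hle
  have hsum := (G.induce (U : Set V)).sum_degrees_eq_twice_card_edges
  have : adjCount G U U = ∑ v, (G.induce (U : Set V)).degree v := by
    rw [adjCount, ← sum_coe_sort U]
    refine sum_congr rfl fun a _ => ?_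
    rw [← SimpleGraph.card_neighborFinset_eq_degree, ← card_map (Function.Embedding.subtype _)]
    congr 1
    ext b
    simp
    tauto
  omega

/-- In a `K_{r+1}`-free graph, a vertex misses some vertex of every `r`-clique. -/
lemma card_filter_adj_clique_lt [DecidableEq V] {r : ℕ} (hG : G.CliqueFree (r + 1)) {C : Finset V}
    (hC : G.IsNClique r C) (v : V) : #{b ∈ C | G.Adj v b} + 1 ≤ r := by
  by_contra hcon
  have hall : {b ∈ C | G.Adj v b} = C := by
    refine eq_of_subset_of_card_le (filter_subset _ _) ?_
    rw [hC.card_eq]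
    omega
  refine hG (insert v C) (hC.insert fun b hb => ?_)
  rw [← hall, mem_filter] at hb
  exact hb.2

/-- Removing disjoint copies of `K_r` from `U` for as long as possible, with `q` the number of
copies removed. -/
lemma exists_card_filter_adj_add_le [DecidableEq V] {r : ℕ} (hr : 2 ≤ r)
    (hG : G.CliqueFree (r + 1)) (U : Finset V) :
    ∃ q : ℕ, (∀ v, #{b ∈ U | G.Adj v b} + q ≤ #U) ∧
      ((r : ℤ) - 1) * adjCount G U U ≤ (r - 2) * (#U : ℤ) ^ 2 + 2 * #U * q - r * q ^ 2 := by
  induction hu : #U using Nat.strong_induction_on generalizing U with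
  | _ u ih =>
    subst hu
    by_cases hfree : G.CliqueFreeOn U r
    · refine ⟨0, fun v => by simpa using card_filter_le _ _, ?_⟩
      obtain ⟨s, rfl⟩ := Nat.exists_eq_add_of_le' hr
      -- No `K_r` remains, so Turán's theorem applies with `r - 1` parts.
      have h1 := adjCount_self_le (by omega) U hfree
      have h2 := SimpleGraph.mul_card_edgeFinset_turanGraph_le (n := #U) (r := s + 1)
      rw [card_edgeFinset_turanGraph_eq (by omega)] at h2
      have h3 : (s + 1) * adjCount G U U ≤ s * #U ^ 2 := by
        calc _ ≤ (s + 1) * (2 * turanNumber (s + 1) #U) := by gcongr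
          _ ≤ _ := by
            rw [Nat.add_sub_cancel] at h2
            linarith
      push_cast
      zify at h3
      linarith
    · obtain ⟨C, hCU, hC⟩ : ∃ C ⊆ U, G.IsNClique r C := by
        simpa [SimpleGraph.CliqueFreeOn] using hfree
      have hcard := card_sdiff_add_card_eq_card hCU
      rw [hC.card_eq] at hcard
      obtain ⟨q, hq, hb⟩ := ih #(U \ C) (by omega) (U \ C) rfl
      have hdis : Disjoint (U \ C) C := sdiff_disjoint
      have hU : U = U \ C ∪ C := (sdiff_union_of_subset hCU).symm
      refine ⟨q + 1, fun v => ?_, ?_⟩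
      · have h1 := card_filter_adj_union G v hdis
        rw [← hU] at h1
        have := card_filter_adj_clique_lt hG hC v
        have := hq v
        omega
      · have h1 : adjCount G U U = adjCount G (U \ C) (U \ C) + 2 * adjCount G (U \ C) C
            + adjCount G C C := by
          conv_lhs => rw [hU]
          rw [adjCount_union_left _ _ hdis, adjCount_union_right _ _ hdis,
            adjCount_union_right _ _ hdis, adjCount_comm G C (U \ C)]
          ring
        have hlt : ∀ a, #{b ∈ C | G.Adj a b} ≤ r - 1 := fun a => by
          have := card_filter_adj_clique_lt hG hC a
          omega
        have h2 : adjCount G (U \ C) C ≤ #(U \ C) * (r - 1) :=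
          adjCount_le G fun a _ => hlt a
        have h3 : adjCount G C C ≤ r * (r - 1) := by
          have := adjCount_le G (A := C) fun a _ => hlt a
          rwa [hC.card_eq] at this
        obtain ⟨s, rfl⟩ := Nat.exists_eq_add_of_le' hr
        rw [h1, ← hcard]
        rw [show s + 2 - 1 = s + 1 by omega] at h2 h3
        have h4 : ((s : ℤ) + 1) * adjCount G (U \ C) C ≤ (s + 1) * (#(U \ C) * (s + 1)) := by
          exact_mod_cast Nat.mul_le_mul_left (s + 1) h2
        have h5 : ((s : ℤ) + 1) * adjCount G C C ≤ (s + 1) * ((s + 2) * (s + 1)) := by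
          exact_mod_cast Nat.mul_le_mul_left (s + 1) h3
        push_cast at hb ⊢
        linarith

end AdjCount

/-! ### Edge bounds and the extremal graphs -/

section Main

variable {V : Type*} [Fintype V] [DecidableEq V] {G : SimpleGraph V} [DecidableRel G.Adj]

variable (G) in
lemma two_mul_card_edgeFinset (S : Finset V) : 2 * #G.edgeFinset =
    adjCount G S S + 2 * adjCount G S Sᶜ + adjCount G Sᶜ Sᶜ := by
  rw [← adjCount_univ, ← union_compl S]
  rw [adjCount_union_left _ _ disjoint_compl_right, adjCount_union_right _ _ disjoint_compl_right,
    adjCount_union_right _ _ disjoint_compl_right, adjCount_comm G Sᶜ S]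
  ring

lemma adjCount_self_add_compl_le {S : Finset V} {d : ℕ} (h : ∀ w ∈ S, G.degree w ≤ d) :
    adjCount G S S + adjCount G S Sᶜ ≤ #S * d := by
  rw [← adjCount_union_right _ _ disjoint_compl_right, union_compl]
  exact adjCount_le G fun a ha => (card_filter_adj_univ G a).trans_le (h a ha)

lemma card_edgeFinset_le_of_degree_le {r : ℕ} (hr : 0 < r) (hG : G.CliqueFree (r + 1))
    {S : Finset V} {d : ℕ} (h : ∀ w ∈ S, G.degree w ≤ d) :
    #G.edgeFinset ≤ turanNumber r #Sᶜ + #S * d := by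
  have h1 := two_mul_card_edgeFinset G S
  have h2 := adjCount_self_add_compl_le h
  have h3 := adjCount_self_le hr Sᶜ hG.cliqueFreeOn
  omega

/-- The boundary case `r = 3`, `k = ⌊n / 2⌋`. -/
lemma card_edgeFinset_lt_of_three {n k : ℕ} (hV : Fintype.card V = n) (hn : 32 ≤ n)
    (hk : 2 * k ≤ n) (hk' : n < 2 * k + 2) (hG : G.CliqueFree 4) {S : Finset V} (hS : #S = k - 1)
    (h : ∀ w ∈ S, G.degree w ≤ k) : #G.edgeFinset < turanNumber 3 (n - 1) + 2 := by
  obtain ⟨s, rfl⟩ : ∃ s, k = s + 1 := ⟨k - 1, by omega⟩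
  rw [Nat.add_sub_cancel] at hS
  obtain ⟨q, hq, hc⟩ := exists_card_filter_adj_add_le (by norm_num) hG Sᶜ
  have h1 := two_mul_card_edgeFinset G S
  have h2 := adjCount_self_add_compl_le h
  have hT : #Sᶜ = n - s := by rw [card_compl, hV, hS]
  have hqu : q ≤ #Sᶜ := by
    obtain ⟨v⟩ := Fintype.card_pos_iff.1 (show 0 < Fintype.card V by omega)
    have := hq v
    omega
  have h3 : adjCount G S Sᶜ ≤ #S * (#Sᶜ - q) :=
    adjCount_le G fun a _ => by have := hq a; omega
  have hm := turanNumber_three (n - 1)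
  have hm' : (n - 1) ^ 2 ≤ 3 * turanNumber 3 (n - 1) + 1 := by
    split_ifs at hm <;> omega
  rw [hS] at h2 h3
  clear hq h hS hm
  generalize adjCount G S S = a at *
  generalize adjCount G S Sᶜ = b at *
  generalize adjCount G Sᶜ Sᶜ = c at *
  generalize #G.edgeFinset = e at *
  generalize turanNumber 3 (n - 1) = t at *
  rcases (show n = 2 * s + 2 ∨ n = 2 * s + 3 by omega) with rfl | rfl
  · rw [show 2 * s + 2 - s = s + 2 by omega] at hT
    rw [show 2 * s + 2 - 1 = 2 * s + 1 by omega] at hm'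
    rw [hT] at h3 hc hqu
    zify [hqu] at h1 h2 h3 hm' ⊢
    push_cast at hc h3
    by_contra! hcon
    -- The `s * q` terms from `h3` and `hc` cancel, leaving `4q - 3q² ≤ 1`, that is `(3q - 1)(q - 1)
    -- ≥ 0`.
    have h4 : (4 : ℤ) * e ≤ 5 * (s * s) + 10 * s + 5 := by
      rcases (show (q : ℤ) = 0 ∨ (1 : ℤ) ≤ q by omega) with h0 | h0
      · rw [h0] at hc
        linarith [Int.natCast_nonneg a]
      · linarith [mul_nonneg (show (0 : ℤ) ≤ 3 * q - 1 by omega) (sub_nonneg.2 h0),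
          sq_nonneg ((q : ℤ) - 1)]
    -- `n ≥ 32` enters here, as `s ≥ 15`.
    have h5 : (15 : ℤ) * s ≤ s * s := by gcongr; omega
    linarith
  · rw [show 2 * s + 3 - s = s + 3 by omega] at hT
    rw [show 2 * s + 3 - 1 = 2 * s + 2 by omega] at hm'
    rw [hT] at h3 hc hqu
    zify [hqu] at h1 h2 h3 hm' ⊢
    push_cast at hc h3
    by_contra! hcon
    have h4 : (4 : ℤ) * e ≤ 5 * (s * s) + 14 * s + 12 := by
      rcases (show (q : ℤ) = 0 ∨ (1 : ℤ) ≤ q by omega) with h0 | h0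
      · rw [h0] at hc
        linarith [Int.natCast_nonneg a]
      · linarith [mul_nonneg (show (0 : ℤ) ≤ 3 * q - 1 by omega) (sub_nonneg.2 h0),
          sq_nonneg ((q : ℤ) - 1)]
    have h5 : (15 : ℤ) * s ≤ s * s := by gcongr; omega
    linarith

/-- The boundary case `r = 4`, `n = 16`, `k = 8`. -/
lemma card_edgeFinset_lt_of_four (hV : Fintype.card V = 16) (hG : G.CliqueFree 5) {S : Finset V}
    (hS : #S = 7) (h : ∀ w ∈ S, G.degree w ≤ 8) : #G.edgeFinset < turanNumber 4 15 + 2 := by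
  obtain ⟨q, hq, hc⟩ := exists_card_filter_adj_add_le (by norm_num) hG Sᶜ
  have h1 := two_mul_card_edgeFinset G S
  have h2 := adjCount_self_add_compl_le h
  have hT : #Sᶜ = 9 := by rw [card_compl, hV, hS]
  have h3 : adjCount G S Sᶜ ≤ #S * (9 - q) :=
    adjCount_le G fun a _ => by have := hq a; omega
  have h4 := adjCount_self_le (by norm_num) Sᶜ (hG.cliqueFreeOn (s := ↑Sᶜ))
  rw [hT, show turanNumber 4 9 = 30 by decide] at h4
  rw [show turanNumber 4 15 = 84 by decide]
  rw [hT] at hc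
  rw [hS] at h2 h3
  -- The plain bound gives `30 + 56 = 86`, exactly the target. For `q ≤ 1` the gain is inside `Sᶜ`
  -- (`hc`); for `q ≥ 2` it is in the edges across (`h3`).
  rcases (show q = 0 ∨ q = 1 ∨ 2 ≤ q by omega) with rfl | rfl | h0
  · norm_num at hc
    omega
  · norm_num at hc
    omega
  · omega

lemma card_edgeFinset_lt {n r k : ℕ} (hV : Fintype.card V = n) (hr : 3 ≤ r)
    (hn : (if r = 3 then 32 else if r = 4 then 16 else 11) ≤ n) (hG : G.CliqueFree (r + 1))
    (hk : 3 ≤ k) (hkn : 2 * k ≤ n) {S : Finset V} (hS : #S = k - 1)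
    (h : ∀ w ∈ S, G.degree w ≤ k) : #G.edgeFinset < turanNumber r (n - 1) + 2 := by
  by_cases h3 : r = 3 ∧ n < 2 * k + 2
  · obtain ⟨rfl, h3⟩ := h3
    exact card_edgeFinset_lt_of_three hV (by simpa using hn) hkn h3 hG hS h
  by_cases h4 : r = 4 ∧ n = 16 ∧ k = 8
  · obtain ⟨rfl, rfl, rfl⟩ := h4
    exact card_edgeFinset_lt_of_four hV hG hS h
  have hle := card_edgeFinset_le_of_degree_le (by omega) hG h
  rw [card_compl, hV, hS, show n - (k - 1) = n - k + 1 by omega, mul_comm] at hle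
  exact hle.trans_lt (turanNumber_add_lt hr hn hk hkn (by omega) h4)

lemma card_edgeFinset_induce_compl_add_degree (v : V) :
    #(G.induce {v}ᶜ).edgeFinset + G.degree v = #G.edgeFinset := by
  rw [G.card_edgeFinset_induce_compl_singleton, G.card_edgeFinset_deleteIncidenceSet]
  exact Nat.sub_add_cancel (by
    rw [← G.card_incidenceFinset_eq_degree]; exact card_le_card (G.incidenceFinset_subset v))

/-- Uniqueness in Turán's theorem: attaining the Turán number makes `H` Turán-maximal. -/
lemma nonempty_iso_turanGraph_of_card_edgeFinset_eq {W : Type*} [Fintype W] {H : SimpleGraph W}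
    [DecidableRel H.Adj] {r m : ℕ} (hr : 0 < r) (hW : Fintype.card W = m)
    (hH : H.CliqueFree (r + 1)) (he : #H.edgeFinset = #(SimpleGraph.turanGraph m r).edgeFinset) :
    Nonempty (H ≃g SimpleGraph.turanGraph m r) := by
  subst hW
  rw [← SimpleGraph.isTuranMaximal_iff_nonempty_iso_turanGraph hr]
  refine ⟨hH, fun K _ hK => ?_⟩
  rw [he, SimpleGraph.card_edgeFinset_turanGraph]
  exact hK.card_edgeFinset_le

end Main

end HamConn

open HamConn in
theorem mainTheorem3 {V : Type*} [Fintype V] [DecidableEq V] (G : SimpleGraph V)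
    [DecidableRel G.Adj] (n r : ℕ) (hV : Fintype.card V = n) (hr : 3 ≤ r)
    (hn : (if r = 3 then 32 else if r = 4 then 16 else 11) ≤ n)
    (hG : G.CliqueFree (r + 1)) :
    (¬ HamConn.IsHamiltonianConnected G →
      G.edgeFinset.card ≤ (SimpleGraph.turanGraph (n - 1) r).edgeFinset.card + 2) ∧
    ((¬ HamConn.IsHamiltonianConnected G ∧
        G.edgeFinset.card = (SimpleGraph.turanGraph (n - 1) r).edgeFinset.card + 2) ↔
      HamConn.IsTuranPlusVertex G r 2) := by
  have hr0 : 0 < r := by omega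
  have hn4 : 4 ≤ Fintype.card V := by split_ifs at hn <;> omega
  have hcard : ∀ v : V, Fintype.card ({v}ᶜ : Set V) = n - 1 := fun v => by
    rw [Fintype.card_compl_set, hV]
    simp
  have key : ¬ IsHamiltonianConnected G →
      G.edgeFinset.card < (SimpleGraph.turanGraph (n - 1) r).edgeFinset.card + 2 ∨
        ∃ v, G.degree v ≤ 2 := by
    intro hH
    obtain ⟨k, hk2, hkn, S, hS, hdeg⟩ := exists_card_of_not_isHamiltonianConnected hn4 hH
    rcases hk2.eq_or_lt with rfl | hk3
    · obtain ⟨v, rfl⟩ := Finset.card_eq_one.1 hS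
      exact Or.inr ⟨v, hdeg v (by simp)⟩
    · rw [card_edgeFinset_turanGraph_eq hr0]
      exact Or.inl (card_edgeFinset_lt hV hr hn hG hk3 (hV ▸ hkn) hS hdeg)
  have hinduce : ∀ v : V, (G.induce {v}ᶜ).edgeFinset.card ≤
      (SimpleGraph.turanGraph (n - 1) r).edgeFinset.card := fun v => by
    have := (hG.comap (SimpleGraph.Embedding.induce ({v}ᶜ : Set V)).isContained).card_edgeFinset_le
    dsimp only at this
    rwa [hcard, ← SimpleGraph.card_edgeFinset_turanGraph] at this
  refine ⟨fun hH => ?_, fun ⟨hH, he⟩ => ⟨hG, ?_⟩, fun ⟨_, v, hv, ⟨φ⟩⟩ => ⟨?_, ?_⟩⟩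
  · rcases key hH with h | ⟨v, hv⟩
    · exact h.le
    · have := card_edgeFinset_induce_compl_add_degree (G := G) v
      have := hinduce v
      omega
  · rcases key hH with h | ⟨v, hv⟩
    · omega
    · have := card_edgeFinset_induce_compl_add_degree (G := G) v
      have := hinduce v
      -- Equality forces both `G.degree v = 2` and tightness of Turán's bound on `G - v`.
      refine ⟨v, by omega, ?_⟩
      rw [hV]
      refine nonempty_iso_turanGraph_of_card_edgeFinset_eq hr0 (hcard v)
        (hG.comap (SimpleGraph.Embedding.induce ({v}ᶜ : Set V)).isContained) (by omega)
  · exact not_isHamiltonianConnected_of_degree_eq_two hn4 hv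
  · rw [← card_edgeFinset_induce_compl_add_degree v, hv, ← hV, φ.card_edgeFinset_eq]
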